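/- Let $n\ge 1$ and let $B_1\subset\mathbb R^n$ be the open unit ball centred at the origin. There is a constant $C>0$, depending only on $n$, such that the following holds. Let $g:B_1\to\mathbb R$ be a (Lebesgue) measurable function such that $g_+:=\max(g,0)\in H^1(B_1)$ and $\|\nabla g_+\|_{L^2(B_1)}\neq 0$, where $\nabla g_+$ is the weak gradient. If $n=1$, assume in addition that $|B_1\cap\{g\le 0\}|>0$. Then $$|B_1\cap\{0<g<1/2\}|\ \ge\ \frac{C}{\|\nabla g_+\|_{L^2(B_1)}^{2}}\;|B_1\cap\{g\ge 1/2\}|^{2}\;|B_1\cap\{g\le 0\}|^{2-\frac{2}{n}},$$ where $|\cdot|$ denotes Lebesgue measure. -/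

import Mathlib

open MeasureTheory Metric
open scoped ContDiff

/-- `G` is the weak (distributional) gradient of `u` on the open set `U ⊆ ℝⁿ`: both are locally
integrable on `U`, and `∫_U u ∂ᵢφ = - ∫_U Gᵢ φ` for all `φ ∈ C_c^∞(U)` and all `i`. -/
structure HasWeakGradientOn {n : ℕ} (U : Set (EuclideanSpace ℝ (Fin n)))
    (u : EuclideanSpace ℝ (Fin n) → ℝ)
    (G : EuclideanSpace ℝ (Fin n) → EuclideanSpace ℝ (Fin n)) : Prop where
  locallyIntegrableOn : LocallyIntegrableOn u U volume
  locallyIntegrableOn_grad : LocallyIntegrableOn G U volume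
  integral_mul_partialDeriv : ∀ φ : EuclideanSpace ℝ (Fin n) → ℝ,
    ContDiff ℝ ∞ φ → HasCompactSupport φ → tsupport φ ⊆ U → ∀ i : Fin n,
      ∫ x in U, u x * fderiv ℝ φ x (EuclideanSpace.single i 1) = - ∫ x in U, G x i * φ x

/-- `u ∈ H¹(U)`: `u ∈ L²(U)` and `u` has a weak gradient on `U` which belongs to `L²(U)`. -/
def MemH1 {n : ℕ} (U : Set (EuclideanSpace ℝ (Fin n)))
    (u : EuclideanSpace ℝ (Fin n) → ℝ) : Prop :=
  MemLp u 2 (volume.restrict U) ∧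
    ∃ G : EuclideanSpace ℝ (Fin n) → EuclideanSpace ℝ (Fin n),
      HasWeakGradientOn U u G ∧ MemLp G 2 (volume.restrict U)

/-- The `L²(U)` norm of a vector field (finite, and not a junk value, when the field is in
`L²(U)`). -/
noncomputable def l2NormOn {n : ℕ} (U : Set (EuclideanSpace ℝ (Fin n)))
    (G : EuclideanSpace ℝ (Fin n) → EuclideanSpace ℝ (Fin n)) : ℝ :=
  (eLpNorm G 2 (volume.restrict U)).toReal

/-! Write `A = {g ≥ 1/2}`, `Z = {g ≤ 0}`, `S = {0 < g < 1/2}` inside the unit ball `B`, and `u =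
g₊`. The core is a two-set Poincaré inequality for `C¹` functions: `∫_Z ∫_A |f x - f y| ≤ C
|Z|^(1/n) ∫_B |∇f|`. Integrate `∇f` along the segment from `y` to `x`. At a fixed time `t`, the
substitution in `x` costs `t⁻ⁿ |Z|` and the substitution in `y` costs `(1-t)⁻ⁿ |A|`. Integrating the
smaller of the two over `t ∈ (0,1)` yields `|Z|^(1/n)` when `n ≥ 2`; for `n = 1` the fundamental
theorem of calculus is enough.

Apply this to `η ∘ u`, where `η` is a `C¹` cutoff equal to `0` on `(-∞, 0]` and `1` on `[1/2, ∞)`.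
The left side is `|A| |Z|`. Since `η'(u)` vanishes off `S`, Cauchy–Schwarz bounds the right side by
a constant times `|Z|^(1/n) |S|^(1/2) ‖∇u‖₂`. Dividing by `|Z|^(1/n)` and squaring gives the claim.

As `u` is only weakly differentiable, it is mollified on balls of radius `r < 1`. Fatou's lemma
handles the left side, a generalized dominated convergence argument the right side, and then `r ↑
1`. The carrying results are `exists_lintegral_lintegral_enorm_sub_le`,
`exists_mul_measure_le_lintegral` and `exists_mul_measure_le_mul_eLpNorm`. -/

/-! ### Integrals over segments joining two sets. -/

section DoubleIntegral

open Set ENNReal Module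

variable {E : Type*} [NormedAddCommGroup E] [NormedSpace ℝ E] [FiniteDimensional ℝ E]
  [MeasurableSpace E] [BorelSpace E] (μ : Measure E) [μ.IsAddHaarMeasure]

theorem lintegral_comp_add_smul {F : E → ℝ≥0∞} (hF : Measurable F) (c : E) {t : ℝ} (ht : t ≠ 0) :
    ∫⁻ x, F (c + t • x) ∂μ = ENNReal.ofReal |(t ^ finrank ℝ E)⁻¹| * ∫⁻ z, F z ∂μ := by
  have h1 : ∫⁻ x, F (c + t • x) ∂μ = ∫⁻ z, F (c + z) ∂(μ.map (t • ·)) := by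
    rw [lintegral_map (by fun_prop) (by fun_prop)]
  rw [h1, Measure.map_addHaar_smul μ ht, lintegral_smul_measure,
    lintegral_add_left_eq_self F c, smul_eq_mul]

variable {A Z B : Set E}

/-- For fixed `y`, the map `x ↦ y + t(x - y)` is a homothety of Jacobian `tⁿ`, and convexity keeps
the image of `A` inside `B`. -/
theorem lintegral_lintegral_segment_le (hB : Convex ℝ B) (hBm : MeasurableSet B)
    (hA : A ⊆ B) (hZ : Z ⊆ B) (hAm : MeasurableSet A) (hZm : MeasurableSet Z)
    {F : E → ℝ≥0∞} (hF : Measurable F) {t : ℝ} (ht0 : 0 < t) (ht1 : t ≤ 1) :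
    ∫⁻ y in Z, ∫⁻ x in A, F (y + t • (x - y)) ∂μ ∂μ ≤
      ENNReal.ofReal (t ^ finrank ℝ E)⁻¹ * μ Z * ∫⁻ z in B, F z ∂μ := by
  have key : ∀ y ∈ Z, ∫⁻ x in A, F (y + t • (x - y)) ∂μ ≤
      ENNReal.ofReal (t ^ finrank ℝ E)⁻¹ * ∫⁻ z in B, F z ∂μ := by
    intro y hy
    calc ∫⁻ x in A, F (y + t • (x - y)) ∂μ
        = ∫⁻ x in A, B.indicator F ((y - t • y) + t • x) ∂μ := by
          refine setLIntegral_congr_fun hAm fun x hx => ?_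
          have e : y + t • (x - y) = (y - t • y) + t • x := by rw [smul_sub]; abel
          have hmem : y + t • (x - y) ∈ B :=
            hB.add_smul_sub_mem (hZ hy) (hA hx) ⟨ht0.le, ht1⟩
          rw [← e, indicator_of_mem hmem]
      _ ≤ ∫⁻ x, B.indicator F ((y - t • y) + t • x) ∂μ := setLIntegral_le_lintegral _ _
      _ = ENNReal.ofReal (t ^ finrank ℝ E)⁻¹ * ∫⁻ z in B, F z ∂μ := by
          rw [lintegral_comp_add_smul μ (hF.indicator hBm) _ ht0.ne', lintegral_indicator hBm,
            abs_of_pos (by positivity)]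
  calc ∫⁻ y in Z, ∫⁻ x in A, F (y + t • (x - y)) ∂μ ∂μ
      ≤ ∫⁻ _ in Z, ENNReal.ofReal (t ^ finrank ℝ E)⁻¹ * ∫⁻ z in B, F z ∂μ ∂μ :=
        setLIntegral_mono' hZm key
    _ = _ := by rw [setLIntegral_const]; ring

/-- The same substitution made in `y`, whose homothety ratio is `1 - t`. It stays bounded as `t →
0`, where the previous estimate blows up. -/
theorem lintegral_lintegral_segment_le' (hB : Convex ℝ B) (hBm : MeasurableSet B)
    (hA : A ⊆ B) (hZ : Z ⊆ B) (hAm : MeasurableSet A) (hZm : MeasurableSet Z)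
    {F : E → ℝ≥0∞} (hF : Measurable F) {t : ℝ} (ht0 : 0 ≤ t) (ht1 : t < 1) :
    ∫⁻ y in Z, ∫⁻ x in A, F (y + t • (x - y)) ∂μ ∂μ ≤
      ENNReal.ofReal ((1 - t) ^ finrank ℝ E)⁻¹ * μ A * ∫⁻ z in B, F z ∂μ := by
  rw [lintegral_lintegral_swap (by fun_prop)]
  have e : ∀ x y : E, y + t • (x - y) = x + (1 - t) • (y - x) := by
    intro x y; module
  simp_rw [e]
  exact lintegral_lintegral_segment_le μ hB hBm hZ hA hZm hAm hF (by linarith) (by linarith)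

omit [FiniteDimensional ℝ E] [MeasurableSpace E] [BorelSpace E] in
theorem enorm_sub_le_lintegral_fderiv {f : E → ℝ} (hf : ContDiff ℝ 1 f) (x y : E) :
    ‖f x - f y‖ₑ ≤ ‖x - y‖ₑ * ∫⁻ t in Ioc (0 : ℝ) 1, ‖fderiv ℝ f (y + t • (x - y))‖ₑ := by
  have hd : ∀ t : ℝ, HasDerivAt (fun t : ℝ => f (y + t • (x - y)))
      (fderiv ℝ f (y + t • (x - y)) (x - y)) t := by
    intro t
    have h1 : HasDerivAt (fun t : ℝ => y + t • (x - y)) (x - y) t := by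
      simpa using ((hasDerivAt_id t).smul_const (x - y)).const_add y
    exact ((hf.differentiable one_ne_zero _).hasFDerivAt).comp_hasDerivAt t h1
  have hcont : Continuous fun t : ℝ => fderiv ℝ f (y + t • (x - y)) (x - y) := by
    have := hf.continuous_fderiv one_ne_zero
    fun_prop
  have h := intervalIntegral.integral_eq_sub_of_hasDerivAt (a := 0) (b := 1)
    (fun t _ => hd t) (hcont.intervalIntegrable _ _)
  have e : f x - f y = ∫ t in Ioc (0 : ℝ) 1, fderiv ℝ f (y + t • (x - y)) (x - y) := by
    rw [← intervalIntegral.integral_of_le zero_le_one, h]; simp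
  rw [e]
  refine (enorm_integral_le_lintegral_enorm _).trans ?_
  rw [← lintegral_const_mul']
  · refine lintegral_mono fun t => ?_
    rw [mul_comm]
    exact ContinuousLinearMap.le_opENorm _ _
  · exact enorm_ne_top

theorem lintegral_lintegral_lintegral_swap_segment {F : E → ℝ≥0∞} (hF : Measurable F)
    (A Z : Set E) :
    ∫⁻ y in Z, ∫⁻ x in A, (∫⁻ t in Ioc (0 : ℝ) 1, F (y + t • (x - y))) ∂μ ∂μ =
      ∫⁻ t in Ioc (0 : ℝ) 1, ∫⁻ y in Z, ∫⁻ x in A, F (y + t • (x - y)) ∂μ ∂μ := by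
  have h : ∀ y, ∫⁻ x in A, (∫⁻ t in Ioc (0 : ℝ) 1, F (y + t • (x - y))) ∂μ =
      ∫⁻ t in Ioc (0 : ℝ) 1, ∫⁻ x in A, F (y + t • (x - y)) ∂μ := by
    intro y
    have m1 : Measurable fun q : E × ℝ => F (y + q.2 • (q.1 - y)) := hF.comp (by fun_prop)
    exact lintegral_lintegral_swap m1.aemeasurable
  rw [lintegral_congr h]
  have m2 : Measurable fun p : (E × ℝ) × E => F (p.1.1 + p.1.2 • (p.2 - p.1.1)) :=
    hF.comp (by fun_prop)
  have m3 : Measurable fun p : E × ℝ => ∫⁻ x in A, F (p.1 + p.2 • (x - p.1)) ∂μ :=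
    m2.lintegral_prod_right'
  exact lintegral_lintegral_swap m3.aemeasurable

theorem lintegral_lintegral_lintegral_segment_le (hB : Convex ℝ B) (hBm : MeasurableSet B)
    (hA : A ⊆ B) (hZ : Z ⊆ B) (hAm : MeasurableSet A) (hZm : MeasurableSet Z)
    {F : E → ℝ≥0∞} (hF : Measurable F) :
    ∫⁻ y in Z, ∫⁻ x in A, (∫⁻ t in Ioc (0 : ℝ) 1, F (y + t • (x - y))) ∂μ ∂μ ≤
      (∫⁻ t in Ioc (0 : ℝ) 1, min (ENNReal.ofReal (t ^ finrank ℝ E)⁻¹ * μ Z)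
        (ENNReal.ofReal ((1 - t) ^ finrank ℝ E)⁻¹ * μ A)) * ∫⁻ z in B, F z ∂μ := by
  -- The null endpoint `t = 1` is dropped because the substitution in `y` degenerates there.
  rw [lintegral_lintegral_lintegral_swap_segment μ hF, ← lintegral_mul_const _ (by fun_prop),
    ← restrict_Ioo_eq_restrict_Ioc]
  refine setLIntegral_mono' measurableSet_Ioo fun t ht => ?_
  rw [min_mul_of_nonneg _ _ zero_le]
  exact le_min
    (lintegral_lintegral_segment_le μ hB hBm hA hZ hAm hZm hF ht.1 ht.2.le)
    (lintegral_lintegral_segment_le' μ hB hBm hA hZ hAm hZm hF ht.1.le ht.2)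

theorem lintegral_lintegral_enorm_sub_le (hB : Convex ℝ B) (hBm : MeasurableSet B)
    (hA : A ⊆ B) (hZ : Z ⊆ B) (hAm : MeasurableSet A) (hZm : MeasurableSet Z) {D : ℝ≥0∞}
    (hDt : D ≠ ⊤) (hD : ∀ x ∈ B, ∀ y ∈ B, ‖x - y‖ₑ ≤ D) {f : E → ℝ} (hf : ContDiff ℝ 1 f) :
    ∫⁻ y in Z, ∫⁻ x in A, ‖f x - f y‖ₑ ∂μ ∂μ ≤
      D * (∫⁻ t in Ioc (0 : ℝ) 1, min (ENNReal.ofReal (t ^ finrank ℝ E)⁻¹ * μ Z)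
        (ENNReal.ofReal ((1 - t) ^ finrank ℝ E)⁻¹ * μ A)) * ∫⁻ z in B, ‖fderiv ℝ f z‖ₑ ∂μ := by
  have hF : Measurable fun z => ‖fderiv ℝ f z‖ₑ :=
    (hf.continuous_fderiv one_ne_zero).enorm.measurable
  refine (setLIntegral_mono' hZm fun y hy => setLIntegral_mono' hAm fun x hx =>
    (enorm_sub_le_lintegral_fderiv hf x y).trans
      (mul_le_mul_left (hD x (hA hx) y (hZ hy)) _)).trans ?_
  simp_rw [lintegral_const_mul' D _ hDt]
  rw [mul_assoc]
  exact mul_le_mul_right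
    (lintegral_lintegral_lintegral_segment_le μ hB hBm hA hZ hAm hZm hF) _

theorem lintegral_Ioi_inv_pow_le {m : ℕ} (hm : 2 ≤ m) {c : ℝ} (hc : 0 < c) :
    ∫⁻ t in Ioi c, ENNReal.ofReal (t ^ m)⁻¹ ≤ ENNReal.ofReal (c ^ (m - 1))⁻¹ := by
  have hm' : (2 : ℝ) ≤ m := by exact_mod_cast hm
  have e : ∀ t ∈ Ioi c, ENNReal.ofReal (t ^ m)⁻¹ = ENNReal.ofReal (t ^ (-(m : ℝ))) := by
    intro t ht
    rw [Real.rpow_neg (hc.trans ht).le, Real.rpow_natCast]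
  rw [setLIntegral_congr_fun measurableSet_Ioi e,
    ← ofReal_integral_eq_lintegral_ofReal (integrableOn_Ioi_rpow_of_lt (by linarith) hc),
    integral_Ioi_rpow_of_lt (by linarith) hc]
  · refine ENNReal.ofReal_le_ofReal ?_
    have h2 : c ^ (-(m : ℝ) + 1) = (c ^ (m - 1))⁻¹ := by
      rw [← Real.rpow_natCast, ← Real.rpow_neg hc.le]
      congr 1
      rw [Nat.cast_sub (by omega)]; simp; ring
    rw [h2, neg_div, ← div_neg, div_le_iff₀ (by linarith)]
    have : 0 < (c ^ (m - 1))⁻¹ := by positivity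
    nlinarith
  · filter_upwards [ae_restrict_mem measurableSet_Ioi] with t ht
    exact Real.rpow_nonneg (hc.trans ht).le _

/-- Split at a time `c` proportional to `s`: on `(0, c]` the second bound is constant up to a
factor, and beyond `c` the tail of `t⁻ᵐ` gives `c^(1-m) s^m`. Both are of order `s`. The tail
converges only for `m ≥ 2`, so dimension one is treated apart. -/
theorem lintegral_min_inv_pow_le {m : ℕ} (hm : 2 ≤ m) {a s : ℝ} (ha : 0 < a) (hs : 0 < s)
    (hsa : s ≤ a) {M : ℝ≥0∞} :
    ∫⁻ t in Ioc (0 : ℝ) 1, min (ENNReal.ofReal (t ^ m)⁻¹ * ENNReal.ofReal (s ^ m))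
        (ENNReal.ofReal ((1 - t) ^ m)⁻¹ * M) ≤
      (ENNReal.ofReal (2 ^ m / (2 * a)) * M + ENNReal.ofReal ((2 * a) ^ (m - 1))) *
        ENNReal.ofReal s := by
  -- The factor `2a` together with `s ≤ a` forces `c ≤ 1/2`, hence `(1 - t)⁻¹ ≤ 2` on `(0, c]`.
  set c : ℝ := s / (2 * a) with hc
  have hc0 : 0 < c := by positivity
  have hc1 : c ≤ 1 / 2 := by rw [hc, div_le_iff₀ (by positivity)]; linarith
  have hsub : Ioc (0 : ℝ) 1 ⊆ Ioc 0 c ∪ Ioi c := fun t ht => by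
    rcases le_or_gt t c with h | h
    · exact Or.inl ⟨ht.1, h⟩
    · exact Or.inr h
  refine (lintegral_mono_set hsub).trans ((lintegral_union_le _ _ _).trans ?_)
  rw [add_mul]
  gcongr ?_ + ?_
  · calc _ ≤ ∫⁻ t in Ioc (0 : ℝ) c, ENNReal.ofReal (2 ^ m) * M := by
          refine setLIntegral_mono' measurableSet_Ioc fun t ht => (min_le_right _ _).trans ?_
          gcongr
          rw [← inv_pow]
          have h1 : (1 / 2 : ℝ) ≤ 1 - t := by linarith [ht.2]
          have : (1 - t)⁻¹ ≤ 2 := by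
            rw [inv_le_comm₀ (by linarith) (by norm_num)]; linarith
          gcongr
      _ = _ := by
          rw [setLIntegral_const, Real.volume_Ioc, sub_zero, mul_right_comm,
            mul_right_comm _ M, ← ENNReal.ofReal_mul (by positivity),
            ← ENNReal.ofReal_mul (by positivity), hc]
          congr 2; field_simp
  · calc _ ≤ ∫⁻ t in Ioi c, ENNReal.ofReal (t ^ m)⁻¹ * ENNReal.ofReal (s ^ m) :=
          lintegral_mono fun t => min_le_left _ _
      _ = (∫⁻ t in Ioi c, ENNReal.ofReal (t ^ m)⁻¹) * ENNReal.ofReal (s ^ m) :=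
          lintegral_mul_const' _ _ ofReal_ne_top
      _ ≤ ENNReal.ofReal (c ^ (m - 1))⁻¹ * ENNReal.ofReal (s ^ m) := by
          gcongr; exact lintegral_Ioi_inv_pow_le hm hc0
      _ = _ := by
          rw [← ENNReal.ofReal_mul (by positivity), ← ENNReal.ofReal_mul (by positivity)]
          congr 1
          obtain ⟨k, rfl⟩ : ∃ k, m = k + 1 := ⟨m - 1, by omega⟩
          simp only [Nat.add_sub_cancel, hc, div_pow, pow_succ s]
          field_simp

end DoubleIntegral

/-! ### Dimension one. -/

section OneDim
open Set ENNReal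

theorem enorm_sub_le_setLIntegral_deriv {f : ℝ → ℝ} (hf : ContDiff ℝ 1 f) {B : Set ℝ}
    (hB : Convex ℝ B) {x y : ℝ} (hx : x ∈ B) (hy : y ∈ B) :
    ‖f x - f y‖ₑ ≤ ∫⁻ z in B, ‖deriv f z‖ₑ := by
  have h := intervalIntegral.integral_deriv_eq_sub (a := y) (b := x) (f := f)
    (fun t _ => hf.differentiable one_ne_zero t)
    ((hf.continuous_deriv le_rfl).intervalIntegrable _ _)
  rw [← h]
  calc _ = ‖∫ z in uIoc y x, deriv f z‖ₑ := by
        simp only [enorm_eq_nnnorm]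
        congr 1
        exact NNReal.eq (intervalIntegral.norm_intervalIntegral_eq _ _ _ _)
    _ ≤ ∫⁻ z in uIoc y x, ‖deriv f z‖ₑ := enorm_integral_le_lintegral_enorm _
    _ ≤ _ := lintegral_mono_set
      (uIoc_subset_uIcc.trans (hB.ordConnected.uIcc_subset hy hx))

/-- Transport of the real-line estimate through a linear isometry, which preserves volume, convexity
and the norm of the derivative. -/
theorem enorm_sub_le_setLIntegral_fderiv {f : EuclideanSpace ℝ (Fin 1) → ℝ}
    (hf : ContDiff ℝ 1 f) {B : Set (EuclideanSpace ℝ (Fin 1))} (hB : Convex ℝ B)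
    {x y : EuclideanSpace ℝ (Fin 1)} (hx : x ∈ B) (hy : y ∈ B) :
    ‖f x - f y‖ₑ ≤ ∫⁻ z in B, ‖fderiv ℝ f z‖ₑ := by
  let e : ℝ ≃ₗᵢ[ℝ] EuclideanSpace ℝ (Fin 1) := (OrthonormalBasis.singleton (Fin 1) ℝ).repr
  have he : MeasurePreserving e := e.measurePreserving
  have hfe : ContDiff ℝ 1 (f ∘ e) := hf.comp e.toContinuousLinearEquiv.contDiff
  have h := enorm_sub_le_setLIntegral_deriv hfe
    (hB.linear_preimage e.toLinearEquiv.toLinearMap) (x := e.symm x) (y := e.symm y)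
    (by simpa using hx) (by simpa using hy)
  simp only [Function.comp_apply, e.apply_symm_apply] at h
  refine h.trans ?_
  rw [← he.setLIntegral_comp_preimage_emb e.toHomeomorph.measurableEmbedding]
  refine lintegral_mono fun t => ?_
  have hd : HasDerivAt (f ∘ e) (fderiv ℝ f (e t) (e 1)) t := by
    have h1 : HasDerivAt e (e 1) t := by
      simpa using (e.toContinuousLinearEquiv : ℝ →L[ℝ] EuclideanSpace ℝ (Fin 1)).hasDerivAt (x := t)
    exact ((hf.differentiable one_ne_zero _).hasFDerivAt).comp_hasDerivAt t h1
  rw [hd.deriv]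
  refine (ContinuousLinearMap.le_opENorm _ _).trans_eq ?_
  have : ‖e 1‖ₑ = 1 := by rw [← ofReal_norm, e.norm_map]; simp
  rw [this, mul_one]

end OneDim

/-! ### The two-set Poincaré inequality for `C¹` functions. -/

section Isoperimetric
open Set ENNReal

/-- The constant is uniform in `r ≤ 1`, since only the diameter bound `2` and `|A|, |Z| ≤ |B₁|`
enter. This uniformity later allows `r ↑ 1`. -/
theorem exists_lintegral_lintegral_enorm_sub_le {n : ℕ} (hn : 1 ≤ n) :
    ∃ C : ℝ, 0 < C ∧ ∀ r ≤ (1 : ℝ), ∀ A Z : Set (EuclideanSpace ℝ (Fin n)),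
      MeasurableSet A → MeasurableSet Z → A ⊆ ball 0 r → Z ⊆ ball 0 r →
      ∀ f : EuclideanSpace ℝ (Fin n) → ℝ, ContDiff ℝ 1 f →
        ∫⁻ y in Z, ∫⁻ x in A, ‖f x - f y‖ₑ ≤
          ENNReal.ofReal C * volume Z ^ (1 / (n : ℝ)) * ∫⁻ z in ball 0 r, ‖fderiv ℝ f z‖ₑ := by
  have hn0 : (0 : ℝ) < n := by exact_mod_cast hn
  set w := (volume (ball (0 : EuclideanSpace ℝ (Fin n)) 1)) with hw
  have hwt : w ≠ ⊤ := measure_ball_lt_top.ne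
  have hw0 : 0 < w.toReal := ENNReal.toReal_pos (measure_ball_pos _ _ one_pos).ne' hwt
  have hsubw : ∀ r ≤ (1 : ℝ), ∀ A : Set (EuclideanSpace ℝ (Fin n)), A ⊆ ball 0 r →
      volume A ≤ w := fun r hr A hA => measure_mono (hA.trans (ball_subset_ball hr))
  rcases hn.eq_or_lt with rfl | hn2
  · refine ⟨w.toReal, hw0, fun r hr A Z hA hZ hAr hZr f hf => ?_⟩
    calc ∫⁻ y in Z, ∫⁻ x in A, ‖f x - f y‖ₑ
        ≤ ∫⁻ y in Z, ∫⁻ x in A, ∫⁻ z in ball 0 r, ‖fderiv ℝ f z‖ₑ :=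
          setLIntegral_mono' hZ fun y hy => setLIntegral_mono' hA fun x hx =>
            enorm_sub_le_setLIntegral_fderiv hf (convex_ball _ _) (hAr hx) (hZr hy)
      _ = volume A * volume Z * ∫⁻ z in ball 0 r, ‖fderiv ℝ f z‖ₑ := by
          rw [setLIntegral_const, setLIntegral_const]; ring
      _ ≤ _ := by
          rw [ENNReal.ofReal_toReal hwt]
          simp only [Nat.cast_one, div_one, ENNReal.rpow_one]
          gcongr
          exact hsubw r hr A hAr
  -- `a = |B₁|^(1/n)` dominates `s = |Z|^(1/n)` for every admissible `Z`. The factor `2` in the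
  -- constant is the diameter bound.
  · set a := w.toReal ^ (1 / (n : ℝ)) with ha
    have ha0 : 0 < a := by positivity
    refine ⟨2 * (2 ^ n / (2 * a) * w.toReal + (2 * a) ^ (n - 1)), by positivity,
      fun r hr A Z hA hZ hAr hZr f hf => ?_⟩
    have hZw := hsubw r hr Z hZr
    have hZt : volume Z ≠ ⊤ := (hZw.trans_lt hwt.lt_top).ne
    rcases eq_or_ne (volume Z) 0 with hZ0 | hZ0
    · rw [Measure.restrict_eq_zero.2 hZ0]; simp
    set s := (volume Z).toReal ^ (1 / (n : ℝ)) with hs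
    have hs0 : 0 < s := Real.rpow_pos_of_pos (ENNReal.toReal_pos hZ0 hZt) _
    have hsa : s ≤ a :=
      Real.rpow_le_rpow toReal_nonneg (ENNReal.toReal_mono hwt hZw) (by positivity)
    have hsn : ENNReal.ofReal (s ^ n) = volume Z := by
      rw [hs, one_div, Real.rpow_inv_natCast_pow toReal_nonneg (by omega),
        ENNReal.ofReal_toReal hZt]
    have hs1 : ENNReal.ofReal s = volume Z ^ (1 / (n : ℝ)) := by
      rw [hs, ENNReal.toReal_rpow, ENNReal.ofReal_toReal
        (ENNReal.rpow_ne_top_of_nonneg (by positivity) hZt)]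
    have h := lintegral_lintegral_enorm_sub_le volume (convex_ball _ r) measurableSet_ball hAr hZr
      hA hZ (D := 2) (by simp) (fun x hx y hy => ?_) hf
    · refine h.trans ?_
      gcongr ?_ * _
      rw [finrank_euclideanSpace_fin, ENNReal.ofReal_mul (by norm_num), mul_assoc]
      gcongr ?_ * ?_
      · simp
      have hA1 : volume A ≤ ENNReal.ofReal w.toReal :=
        (hsubw r hr A hAr).trans_eq (ENNReal.ofReal_toReal hwt).symm
      calc _ ≤ ∫⁻ t in Ioc (0 : ℝ) 1, min (ENNReal.ofReal (t ^ n)⁻¹ * ENNReal.ofReal (s ^ n))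
            (ENNReal.ofReal ((1 - t) ^ n)⁻¹ * ENNReal.ofReal w.toReal) := by
            rw [hsn]; gcongr
        _ ≤ _ := lintegral_min_inv_pow_le hn2 ha0 hs0 hsa
        _ = _ := by
            rw [hs1, ENNReal.ofReal_add (by positivity) (by positivity),
              ENNReal.ofReal_mul (by positivity)]
    · rw [← ofReal_norm]
      have h1 := mem_ball_zero_iff.1 hx
      have h2 := mem_ball_zero_iff.1 hy
      have : ‖x - y‖ ≤ 2 := (norm_sub_le _ _).trans (by linarith)
      exact (ENNReal.ofReal_le_ofReal this).trans (by simp)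

end Isoperimetric

/-! ### Passage to the limit under the integral. -/

section Limits
open Set ENNReal Filter Topology

/-- Reverse Fatou with a moving majorant (Pratt): apply Fatou to `h k - f k ≥ 0` and cancel the
common finite value of `∫ h k`. -/
theorem limsup_lintegral_le_of_tendsto_of_le {α : Type*} [MeasurableSpace α] {μ : Measure α}
    {f h : ℕ → α → ℝ≥0∞} {f' h' : α → ℝ≥0∞} (hf : ∀ k, AEMeasurable (f k) μ)
    (hh : ∀ k, AEMeasurable (h k) μ) (hle : ∀ k, f k ≤ᵐ[μ] h k)
    (hf' : ∀ᵐ x ∂μ, Tendsto (fun k => f k x) atTop (𝓝 (f' x)))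
    (hh' : ∀ᵐ x ∂μ, Tendsto (fun k => h k x) atTop (𝓝 (h' x)))
    (hint : ∀ k, ∫⁻ x, h k x ∂μ = ∫⁻ x, h' x ∂μ) (hfin : ∫⁻ x, h' x ∂μ ≠ ⊤) :
    limsup (fun k => ∫⁻ x, f k x ∂μ) atTop ≤ ∫⁻ x, f' x ∂μ := by
  have hh'm : AEMeasurable h' μ := aemeasurable_of_tendsto_metrizable_ae atTop hh hh'
  have hf'm : AEMeasurable f' μ := aemeasurable_of_tendsto_metrizable_ae atTop hf hf'
  have hle' : f' ≤ᵐ[μ] h' := by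
    filter_upwards [hf', hh', ae_all_iff.2 hle] with x h1 h2 h3
    exact le_of_tendsto_of_tendsto' h1 h2 h3
  have hPk : ∀ k, ∫⁻ x, f k x ∂μ ≤ ∫⁻ x, h' x ∂μ := fun k =>
    (lintegral_mono_ae (hle k)).trans_eq (hint k)
  have hP : ∫⁻ x, f' x ∂μ ≤ ∫⁻ x, h' x ∂μ := lintegral_mono_ae hle'
  have hDk : ∀ k, ∫⁻ x, (h k x - f k x) ∂μ = ∫⁻ x, h' x ∂μ - ∫⁻ x, f k x ∂μ := fun k => by
    rw [lintegral_sub' (hf k) ((hPk k).trans_lt hfin.lt_top).ne (hle k), hint]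
  have hD : ∫⁻ x, (h' x - f' x) ∂μ = ∫⁻ x, h' x ∂μ - ∫⁻ x, f' x ∂μ :=
    lintegral_sub' hf'm (hP.trans_lt hfin.lt_top).ne hle'
  have hfatou : ∫⁻ x, (h' x - f' x) ∂μ ≤
      liminf (fun k => ∫⁻ x, (h k x - f k x) ∂μ) atTop := by
    refine le_trans (lintegral_mono_ae ?_)
      (lintegral_liminf_le' fun k => (hh k).sub (hf k))
    filter_upwards [hf', hh', ae_lt_top' hh'm hfin] with x h1 h2 h3
    exact (ENNReal.Tendsto.sub h2 h1 (Or.inl h3.ne)).liminf_eq.ge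
  have hlim : limsup (fun k => ∫⁻ x, f k x ∂μ) atTop =
      ∫⁻ x, h' x ∂μ - liminf (fun k => ∫⁻ x, (h k x - f k x) ∂μ) atTop := by
    rw [← ENNReal.limsup_const_sub _ _ hfin]
    congr 1
    ext k
    rw [hDk, ENNReal.sub_sub_cancel hfin (hPk k)]
  rw [hlim, ← ENNReal.sub_sub_cancel hfin hP, ← hD]
  exact tsub_le_tsub_left hfatou _

theorem lintegral_lintegral_enorm_sub_le_liminf {α : Type*} [MeasurableSpace α] {μ ν : Measure α}
    [SFinite μ] [SFinite ν] {f : ℕ → α → ℝ} {f' : α → ℝ} (hf : ∀ k, Measurable (f k))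
    (hμ : ∀ᵐ x ∂μ, Tendsto (fun k => f k x) atTop (𝓝 (f' x)))
    (hν : ∀ᵐ x ∂ν, Tendsto (fun k => f k x) atTop (𝓝 (f' x))) :
    ∫⁻ y, ∫⁻ x, ‖f' x - f' y‖ₑ ∂μ ∂ν ≤
      liminf (fun k => ∫⁻ y, ∫⁻ x, ‖f k x - f k y‖ₑ ∂μ ∂ν) atTop := by
  calc ∫⁻ y, ∫⁻ x, ‖f' x - f' y‖ₑ ∂μ ∂ν
      ≤ ∫⁻ y, liminf (fun k => ∫⁻ x, ‖f k x - f k y‖ₑ ∂μ) atTop ∂ν := by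
        refine lintegral_mono_ae ?_
        filter_upwards [hν] with y hy
        refine le_trans (lintegral_mono_ae ?_)
          (lintegral_liminf_le fun k => ((hf k).sub_const _).enorm)
        filter_upwards [hμ] with x hx
        exact (hx.sub hy).enorm.liminf_eq.ge
    _ ≤ _ := by
        refine lintegral_liminf_le fun k => ?_
        have h1 : Measurable fun p : α × α => ‖f k p.2 - f k p.1‖ₑ :=
          (((hf k).comp measurable_snd).sub ((hf k).comp measurable_fst)).enorm
        exact h1.lintegral_prod_right'

end Limits

/-! ### Mollification of weak gradients. -/

section Mollification
open Set Filter Topology ContinuousLinearMap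
open scoped Convolution RealInnerProductSpace

variable {n : ℕ}

/-- Test the weak gradient against `y ↦ ψ (x - y)`, whose support lies in `U` by `hx`. The sign from
the reflection cancels the one from integration by parts. -/
theorem HasWeakGradientOn.fderiv_convolution {U : Set (EuclideanSpace ℝ (Fin n))}
    {u : EuclideanSpace ℝ (Fin n) → ℝ}
    {G : EuclideanSpace ℝ (Fin n) → EuclideanSpace ℝ (Fin n)}
    (h : HasWeakGradientOn U u G) (hU : MeasurableSet U)
    (hu : Integrable (U.indicator u)) (hG : Integrable (U.indicator G))
    {ψ : EuclideanSpace ℝ (Fin n) → ℝ} (hψ : ContDiff ℝ ∞ ψ) (hψc : HasCompactSupport ψ)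
    {x : EuclideanSpace ℝ (Fin n)} (hx : ∀ y, x - y ∈ tsupport ψ → y ∈ U) :
    fderiv ℝ (ψ ⋆[lsmul ℝ ℝ, volume] U.indicator u) x =
      innerSL ℝ ((ψ ⋆[lsmul ℝ ℝ, volume] U.indicator G) x) := by
  have hψ1 : ContDiff ℝ 1 ψ := hψ.of_le (by exact_mod_cast le_top)
  rw [(hψc.hasFDerivAt_convolution_left (lsmul ℝ ℝ) hψ1 hu.locallyIntegrable x).fderiv]
  have hex : ConvolutionExistsAt (fderiv ℝ ψ) (U.indicator u) x
      ((lsmul ℝ ℝ : ℝ →L[ℝ] ℝ →L[ℝ] ℝ).precompL (EuclideanSpace ℝ (Fin n))) volume :=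
    (hψc.fderiv ℝ).convolutionExists_left _ (hψ1.continuous_fderiv one_ne_zero)
      hu.locallyIntegrable x
  have hexG : ConvolutionExistsAt ψ (U.indicator G) x (lsmul ℝ ℝ) volume :=
    hψc.convolutionExists_left _ hψ.continuous hG.locallyIntegrable x
  have hint : Integrable fun t => ψ (x - t) • U.indicator G t := hexG.integrable_swap
  have hχ : ContDiff ℝ ∞ fun y => ψ (x - y) := hψ.comp (contDiff_const.sub contDiff_id)
  have hχc : HasCompactSupport fun y => ψ (x - y) :=
    hψc.comp_homeomorph (Homeomorph.subLeft x)
  have hχU : tsupport (fun y => ψ (x - y)) ⊆ U := by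
    intro y hy
    refine hx y ?_
    have := tsupport_comp_subset_preimage ψ (f := fun y => x - y) (by fun_prop) hy
    exact this
  have hbasis : ∀ i, ((fderiv ℝ ψ ⋆[(lsmul ℝ ℝ).precompL (EuclideanSpace ℝ (Fin n)), volume]
      U.indicator u) x) (EuclideanSpace.single i 1) =
      innerSL ℝ ((ψ ⋆[lsmul ℝ ℝ, volume] U.indicator G) x) (EuclideanSpace.single i 1) := by
    intro i
    have hd : ∀ y, fderiv ℝ (fun y => ψ (x - y)) y (EuclideanSpace.single i 1) =
        - fderiv ℝ ψ (x - y) (EuclideanSpace.single i 1) := by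
      intro y
      have h1 : HasFDerivAt (fun y : EuclideanSpace ℝ (Fin n) => x - y)
          (-(ContinuousLinearMap.id ℝ _)) y := (hasFDerivAt_id y).const_sub x
      have h2 := ((hψ1.differentiable one_ne_zero (x - y)).hasFDerivAt).comp y h1
      have h3 : fderiv ℝ (fun y => ψ (x - y)) y = _ := h2.fderiv
      rw [h3]; simp
    have hw := h.integral_mul_partialDeriv _ hχ hχc hχU i
    simp_rw [hd] at hw
    have hL : ((fderiv ℝ ψ ⋆[(lsmul ℝ ℝ).precompL (EuclideanSpace ℝ (Fin n)), volume]
        U.indicator u) x) (EuclideanSpace.single i 1) =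
        ∫ y in U, u y * fderiv ℝ ψ (x - y) (EuclideanSpace.single i 1) := by
      rw [convolution_eq_swap, ContinuousLinearMap.integral_apply hex.integrable_swap,
        ← integral_indicator hU]
      refine integral_congr_ae (Eventually.of_forall fun y => ?_)
      by_cases hy : y ∈ U <;> simp [hy, mul_comm]
    have hR : innerSL ℝ ((ψ ⋆[lsmul ℝ ℝ, volume] U.indicator G) x)
        (EuclideanSpace.single i 1) = ∫ y in U, G y i * ψ (x - y) := by
      rw [innerSL_apply_apply, EuclideanSpace.inner_single_right, convolution_eq_swap,
        ← integral_indicator hU]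
      have e := (EuclideanSpace.proj (𝕜 := ℝ) i).integral_comp_comm hint
      simp only [EuclideanSpace.coe_proj] at e
      simp only [lsmul_apply, one_mul, conj_trivial]
      rw [← e]
      refine integral_congr_ae (Eventually.of_forall fun y => ?_)
      by_cases hy : y ∈ U <;> simp [hy, mul_comm]
    rw [hL, hR]
    simp only [mul_neg, integral_neg, neg_inj] at hw
    exact hw
  have : ((fderiv ℝ ψ ⋆[(lsmul ℝ ℝ).precompL (EuclideanSpace ℝ (Fin n)), volume]
      U.indicator u) x : EuclideanSpace ℝ (Fin n) →ₗ[ℝ] ℝ) =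
      innerSL ℝ ((ψ ⋆[lsmul ℝ ℝ, volume] U.indicator G) x) := by
    refine (EuclideanSpace.basisFun (Fin n) ℝ).toBasis.ext fun i => ?_
    simpa using hbasis i
  exact ContinuousLinearMap.coe_injective this

theorem norm_convolution_le {E F : Type*} [NormedAddCommGroup E] [NormedSpace ℝ E]
    [MeasurableSpace E] [NormedAddCommGroup F] [NormedSpace ℝ F] {μ : Measure E}
    {ψ : E → ℝ} (hψ : ∀ x, 0 ≤ ψ x) (H : E → F) (x : E) :
    ‖(ψ ⋆[lsmul ℝ ℝ, μ] H) x‖ ≤ (ψ ⋆[lsmul ℝ ℝ, μ] fun y => ‖H y‖) x := by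
  refine (norm_integral_le_integral_norm _).trans_eq ?_
  refine integral_congr_ae (Eventually.of_forall fun y => ?_)
  simp [norm_smul, abs_of_nonneg (hψ y)]

end Mollification

/-! ### The cutoff function. -/

section Cutoff
open Set

theorem exists_contDiff_cutoff {b : ℝ} (hb : 0 < b) :
    ∃ η : ℝ → ℝ, ContDiff ℝ 1 η ∧ (∀ t ≤ 0, η t = 0) ∧ (∀ t, b ≤ t → η t = 1) ∧
      ∃ M : ℝ, 0 < M ∧ ∀ t, ‖deriv η t‖ ≤ (Ioo 0 b).indicator (fun _ => M) t := by
  set η : ℝ → ℝ := fun t => Real.smoothTransition (t / b) with hη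
  have hc : ContDiff ℝ 1 η := Real.smoothTransition.contDiff.comp (contDiff_id.div_const b)
  have h0 : ∀ t ≤ 0, η t = 0 := fun t ht =>
    Real.smoothTransition.zero_of_nonpos (div_nonpos_of_nonpos_of_nonneg ht hb.le)
  have h1 : ∀ t, b ≤ t → η t = 1 := fun t ht =>
    Real.smoothTransition.one_of_one_le ((one_le_div hb).2 ht)
  obtain ⟨M, hM⟩ := (isCompact_Icc (a := 0) (b := b)).exists_bound_of_continuousOn
    (hc.continuous_deriv le_rfl).continuousOn
  refine ⟨η, hc, h0, h1, max M 1, by positivity, fun t => ?_⟩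
  by_cases ht : t ∈ Ioo 0 b
  · rw [indicator_of_mem ht]
    exact (hM t (Ioo_subset_Icc_self ht)).trans (le_max_left _ _)
  · rw [indicator_of_notMem ht, norm_le_zero_iff]
    rcases le_or_gt t 0 with h | h
    · refine IsLocalMin.deriv_eq_zero (Filter.Eventually.of_forall fun s => ?_)
      rw [h0 t h]
      exact Real.smoothTransition.nonneg _
    · have hbt : b ≤ t := by
        by_contra hlt
        exact ht ⟨h, not_le.1 hlt⟩
      refine IsLocalMax.deriv_eq_zero (Filter.Eventually.of_forall fun s => ?_)
      rw [h1 t hbt]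
      exact Real.smoothTransition.le_one _

end Cutoff

/-! ### The inequality for weakly differentiable functions. -/

section WeakIsoperimetric
open Set Filter Topology ENNReal ContinuousLinearMap
open scoped Convolution

/-- Mollify first and compose with `η` afterwards: the classical chain rule then applies to smooth
functions, and no chain rule for weak gradients is needed. -/
theorem exists_mul_measure_le_lintegral {n : ℕ} (hn : 1 ≤ n) :
    ∃ C : ℝ, 0 < C ∧ ∀ (u : EuclideanSpace ℝ (Fin n) → ℝ)
      (G : EuclideanSpace ℝ (Fin n) → EuclideanSpace ℝ (Fin n)),
      HasWeakGradientOn (ball 0 1) u G → Integrable ((ball 0 1).indicator u) →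
      Integrable ((ball 0 1).indicator G) → ∀ r < (1 : ℝ),
      ∀ A Z : Set (EuclideanSpace ℝ (Fin n)),
      MeasurableSet A → MeasurableSet Z → A ⊆ ball 0 r → Z ⊆ ball 0 r →
      ∀ (η : ℝ → ℝ) (M : ℝ), ContDiff ℝ 1 η → (∀ t, ‖deriv η t‖ ≤ M) →
        ∫⁻ y in Z, ∫⁻ x in A, ‖η (u x) - η (u y)‖ₑ ≤
          ENNReal.ofReal C * volume Z ^ (1 / (n : ℝ)) *
            ∫⁻ x in ball 0 1, ‖deriv η (u x)‖ₑ * ‖G x‖ₑ := by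
  obtain ⟨C, hC, H⟩ := exists_lintegral_lintegral_enorm_sub_le hn
  refine ⟨C, hC, fun u G h hu hG r hr A Z hA hZ hAr hZr η M hη hM => ?_⟩
  have hr1 : 0 < 1 - r := by linarith
  set B := ball (0 : EuclideanSpace ℝ (Fin n)) 1 with hB
  set K : ℝ≥0∞ := ENNReal.ofReal C * volume Z ^ (1 / (n : ℝ)) with hK
  have hM0 : 0 ≤ M := (norm_nonneg _).trans (hM 0)
  have hZt : volume Z ≠ ⊤ :=
    ((measure_mono hZr).trans_lt measure_ball_lt_top).ne
  have hKt : K ≠ ⊤ := ENNReal.mul_ne_top ofReal_ne_top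
    (ENNReal.rpow_ne_top_of_nonneg (by positivity) hZt)
  -- The `+ 2` keeps the outer radius strictly below `1 - r` already at `k = 0`, so points of `ball
  -- 0 r` see only values in `B`. The fixed ratio of radii is what almost everywhere convergence of
  -- the mollifications requires.
  let φ : ℕ → ContDiffBump (0 : EuclideanSpace ℝ (Fin n)) := fun k =>
    ⟨(1 - r) / (k + 2) / 2, (1 - r) / (k + 2), by positivity, half_lt_self (by positivity)⟩
  have hφ0 : Tendsto (fun k => (φ k).rOut) atTop (𝓝 0) := by
    have : Tendsto (fun k : ℕ => (1 - r) / ((k : ℝ) + 2)) atTop (𝓝 0) :=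
      (tendsto_const_nhds (x := 1 - r)).div_atTop
        (tendsto_atTop_add_const_right _ _ tendsto_natCast_atTop_atTop)
    exact this
  have hφ2 : ∀ᶠ k in atTop, (φ k).rOut ≤ 2 * (φ k).rIn := Eventually.of_forall fun k => by
    change (1 - r) / ((k : ℝ) + 2) ≤ 2 * ((1 - r) / ((k : ℝ) + 2) / 2)
    linarith
  have hφr : ∀ k, (φ k).rOut < 1 - r := fun k => by
    change (1 - r) / ((k : ℝ) + 2) < 1 - r
    exact div_lt_self hr1 (by have : (0 : ℝ) ≤ k := k.cast_nonneg
                              linarith)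
  let ψ : ℕ → EuclideanSpace ℝ (Fin n) → ℝ := fun k => (φ k).normed volume
  have hψs : ∀ k, ContDiff ℝ ∞ (ψ k) := fun k => (φ k).contDiff_normed
  have hψc : ∀ k, HasCompactSupport (ψ k) := fun k => (φ k).hasCompactSupport_normed
  have hψ0 : ∀ k x, 0 ≤ ψ k x := fun k x => (φ k).nonneg_normed x
  let w : ℕ → EuclideanSpace ℝ (Fin n) → ℝ := fun k =>
    ψ k ⋆[lsmul ℝ ℝ, volume] B.indicator u
  let V : ℕ → EuclideanSpace ℝ (Fin n) → EuclideanSpace ℝ (Fin n) := fun k =>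
    ψ k ⋆[lsmul ℝ ℝ, volume] B.indicator G
  -- `N k` is the moving majorant of `‖V k‖`. As `ψ k` has mass one, its integral is that of `‖G‖`
  -- over `B` for every `k`.
  let N : ℕ → EuclideanSpace ℝ (Fin n) → ℝ := fun k =>
    ψ k ⋆[lsmul ℝ ℝ, volume] fun y => ‖B.indicator G y‖
  have hw1 : ∀ k, ContDiff ℝ 1 (w k) := fun k =>
    (hψc k).contDiff_convolution_left (n := 1) _
      ((hψs k).of_le (by exact_mod_cast le_top)) hu.locallyIntegrable
  have hVc : ∀ k, Continuous (V k) := fun k =>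
    (hψc k).continuous_convolution_left _ (hψs k).continuous hG.locallyIntegrable
  have hNc : ∀ k, Continuous (N k) := fun k =>
    (hψc k).continuous_convolution_left _ (hψs k).continuous hG.norm.locallyIntegrable
  have hψi : ∀ k, Integrable (ψ k) := fun k => (φ k).integrable_normed
  have hN0 : ∀ k x, 0 ≤ N k x := fun k x =>
    integral_nonneg fun y => mul_nonneg (hψ0 k y) (norm_nonneg _)
  have hNi : ∀ k, ∫⁻ x, ENNReal.ofReal (N k x) = ∫⁻ x, ‖B.indicator G x‖ₑ := fun k => by
    have hi : Integrable (N k) := (hψi k).integrable_convolution _ hG.norm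
    rw [← ofReal_integral_eq_lintegral_ofReal hi (Eventually.of_forall (hN0 k)),
      ← ofReal_integral_norm_eq_lintegral_enorm hG]
    congr 1
    have := integral_convolution (lsmul ℝ ℝ) (hψi k) hG.norm
    rw [this, (φ k).integral_normed]; simp
  have hwlim : ∀ᵐ x, Tendsto (fun k => w k x) atTop (𝓝 (B.indicator u x)) :=
    ContDiffBump.ae_convolution_tendsto_right_of_locallyIntegrable hφ0 hφ2 hu.locallyIntegrable
  have hVlim : ∀ᵐ x, Tendsto (fun k => V k x) atTop (𝓝 (B.indicator G x)) :=
    ContDiffBump.ae_convolution_tendsto_right_of_locallyIntegrable hφ0 hφ2 hG.locallyIntegrable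
  have hNlim : ∀ᵐ x, Tendsto (fun k => N k x) atTop (𝓝 ‖B.indicator G x‖) :=
    ContDiffBump.ae_convolution_tendsto_right_of_locallyIntegrable hφ0 hφ2
      hG.norm.locallyIntegrable
  have hderiv : Continuous (deriv η) := hη.continuous_deriv le_rfl
  have hstep : ∀ k, ∫⁻ y in Z, ∫⁻ x in A, ‖η (w k x) - η (w k y)‖ₑ ≤
      K * ∫⁻ x, ‖deriv η (w k x)‖ₑ * ‖V k x‖ₑ := fun k => by
    refine (H r hr.le A Z hA hZ hAr hZr (η ∘ w k) (hη.comp (hw1 k))).trans ?_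
    -- The identity `∇(w k) = V k` is available only on `ball 0 r`; once it has been used there, the
    -- integral is enlarged to the whole space.
    refine mul_le_mul_right ((setLIntegral_mono' measurableSet_ball fun x hx => ?_).trans
      (setLIntegral_le_lintegral (ball 0 r) _)) K
    have hgrad : fderiv ℝ (w k) x = innerSL ℝ (V k x) := by
      refine h.fderiv_convolution measurableSet_ball hu hG (hψs k) (hψc k) fun y hy => ?_
      rw [(φ k).tsupport_normed_eq, mem_closedBall_zero_iff] at hy
      rw [mem_ball_zero_iff] at hx ⊢
      have h1 : ‖y‖ ≤ ‖x‖ + ‖x - y‖ := by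
        have := norm_sub_le x (x - y)
        rwa [_root_.sub_sub_cancel] at this
      linarith [hφr k]
    have hcomp : fderiv ℝ (η ∘ w k) x = deriv η (w k x) • fderiv ℝ (w k) x :=
      (((hη.differentiable one_ne_zero _).hasDerivAt).comp_hasFDerivAt x
        ((hw1 k).differentiable one_ne_zero x).hasFDerivAt).fderiv
    rw [hcomp, hgrad, enorm_smul, ← ofReal_norm (innerSL ℝ (V k x)), innerSL_apply_norm,
      ofReal_norm]
  have hpratt : limsup (fun k => ∫⁻ x, ‖deriv η (w k x)‖ₑ * ‖V k x‖ₑ) atTop ≤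
      ∫⁻ x, ‖deriv η (B.indicator u x)‖ₑ * ‖B.indicator G x‖ₑ := by
    refine limsup_lintegral_le_of_tendsto_of_le
      (h := fun k x => ENNReal.ofReal M * ENNReal.ofReal (N k x))
      (h' := fun x => ENNReal.ofReal M * ‖B.indicator G x‖ₑ)
      (fun k => ?_) (fun k => ?_) (fun k => ?_) ?_ ?_ (fun k => ?_) ?_
    · exact ((hderiv.comp (hw1 k).continuous).enorm.measurable.mul
        (hVc k).enorm.measurable).aemeasurable
    · exact ((hNc k).measurable.ennreal_ofReal.const_mul _).aemeasurable
    · refine Eventually.of_forall fun x => ?_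
      simp only [← ofReal_norm]
      gcongr
      · exact hM _
      · exact norm_convolution_le (hψ0 k) _ x
    · filter_upwards [hwlim, hVlim] with x h1 h2
      exact ENNReal.Tendsto.mul ((hderiv.tendsto _).comp h1).enorm (Or.inr enorm_ne_top)
        h2.enorm (Or.inr enorm_ne_top)
    · filter_upwards [hNlim] with x h1
      rw [← ofReal_norm]
      exact ENNReal.Tendsto.const_mul (ENNReal.tendsto_ofReal h1) (Or.inr ofReal_ne_top)
    · rw [lintegral_const_mul' _ _ ofReal_ne_top, lintegral_const_mul' _ _ ofReal_ne_top, hNi]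
    · rw [lintegral_const_mul' _ _ ofReal_ne_top]
      exact ENNReal.mul_ne_top ofReal_ne_top hG.hasFiniteIntegral.ne
  have hrB : ball (0 : EuclideanSpace ℝ (Fin n)) r ⊆ B := ball_subset_ball hr.le
  have hηlim : ∀ᵐ x, Tendsto (fun k => η (w k x)) atTop (𝓝 (η (B.indicator u x))) := by
    filter_upwards [hwlim] with x hx
    exact (hη.continuous.tendsto _).comp hx
  calc ∫⁻ y in Z, ∫⁻ x in A, ‖η (u x) - η (u y)‖ₑ
      = ∫⁻ y in Z, ∫⁻ x in A, ‖η (B.indicator u x) - η (B.indicator u y)‖ₑ := by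
        refine setLIntegral_congr_fun hZ fun y hy => setLIntegral_congr_fun hA fun x hx => ?_
        rw [indicator_of_mem (hrB (hZr hy)), indicator_of_mem (hrB (hAr hx))]
    _ ≤ liminf (fun k => ∫⁻ y in Z, ∫⁻ x in A, ‖η (w k x) - η (w k y)‖ₑ) atTop :=
        lintegral_lintegral_enorm_sub_le_liminf
          (fun k => (hη.continuous.comp (hw1 k).continuous).measurable)
          (ae_restrict_of_ae hηlim) (ae_restrict_of_ae hηlim)
    _ ≤ liminf (fun k => K * ∫⁻ x, ‖deriv η (w k x)‖ₑ * ‖V k x‖ₑ) atTop :=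
        liminf_le_liminf (Eventually.of_forall hstep)
    _ ≤ limsup (fun k => K * ∫⁻ x, ‖deriv η (w k x)‖ₑ * ‖V k x‖ₑ) atTop := liminf_le_limsup
    _ = K * limsup (fun k => ∫⁻ x, ‖deriv η (w k x)‖ₑ * ‖V k x‖ₑ) atTop :=
        ENNReal.limsup_const_mul_of_ne_top hKt
    _ ≤ K * ∫⁻ x, ‖deriv η (B.indicator u x)‖ₑ * ‖B.indicator G x‖ₑ := by gcongr
    _ = K * ∫⁻ x in B, ‖deriv η (u x)‖ₑ * ‖G x‖ₑ := by
        rw [← lintegral_indicator (s := B) measurableSet_ball]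
        congr 1
        refine lintegral_congr fun x => ?_
        by_cases hx : x ∈ B <;> simp [hx]

end WeakIsoperimetric

/-! ### Cauchy–Schwarz, exhaustion of the ball, and conclusion. -/

section Main
open Set Filter Topology ENNReal

theorem measure_mul_measure_le_of_forall_ball {n : ℕ} {A Z : Set (EuclideanSpace ℝ (Fin n))}
    {c : ℝ≥0∞} (hA : A ⊆ ball 0 1) (hZ : Z ⊆ ball 0 1)
    (h : ∀ r < (1 : ℝ), volume (A ∩ ball 0 r) * volume (Z ∩ ball 0 r) ≤ c) :
    volume A * volume Z ≤ c := by
  have hr : ∀ S : Set (EuclideanSpace ℝ (Fin n)), S ⊆ ball 0 1 →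
      Tendsto (fun k : ℕ => volume (S ∩ ball 0 (1 - 1 / ((k : ℝ) + 1)))) atTop
        (𝓝 (volume S)) := by
    intro S hS
    have hmono : Monotone fun k : ℕ => S ∩ ball 0 (1 - 1 / ((k : ℝ) + 1)) := by
      intro k l hkl
      refine inter_subset_inter_right _ (ball_subset_ball ?_)
      have := one_div_le_one_div_of_le (a := (k : ℝ) + 1) (b := (l : ℝ) + 1) (by positivity)
        (by exact_mod_cast Nat.succ_le_succ hkl)
      linarith
    have hU : ⋃ k : ℕ, S ∩ ball 0 (1 - 1 / ((k : ℝ) + 1)) = S := by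
      rw [← inter_iUnion, inter_eq_left]
      intro x hx
      have hx1 := mem_ball_zero_iff.1 (hS hx)
      obtain ⟨k, hk⟩ := exists_nat_one_div_lt (sub_pos.2 hx1)
      exact mem_iUnion.2 ⟨k, mem_ball_zero_iff.2 (by linarith)⟩
    have := tendsto_measure_iUnion_atTop (μ := volume) hmono
    rwa [hU] at this
  have hfin : ∀ S : Set (EuclideanSpace ℝ (Fin n)), S ⊆ ball 0 1 → volume S ≠ ⊤ :=
    fun S hS => ((measure_mono hS).trans_lt measure_ball_lt_top).ne
  refine le_of_tendsto' (ENNReal.Tendsto.mul (hr A hA) (Or.inr (hfin Z hZ)) (hr Z hZ)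
    (Or.inr (hfin A hA))) fun k => h _ ?_
  have : 0 < 1 / ((k : ℝ) + 1) := by positivity
  linarith

/-- The conditions on `A`, `Z`, `S` are only almost everywhere, so that these sets may be defined
from a measurable representative of `g`. -/
theorem exists_mul_measure_le_mul_eLpNorm {n : ℕ} (hn : 1 ≤ n) :
    ∃ C : ℝ, 0 < C ∧ ∀ (u : EuclideanSpace ℝ (Fin n) → ℝ)
      (G : EuclideanSpace ℝ (Fin n) → EuclideanSpace ℝ (Fin n)),
      HasWeakGradientOn (ball 0 1) u G → Integrable ((ball 0 1).indicator u) →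
      MemLp G 2 (volume.restrict (ball 0 1)) →
      ∀ A Z S : Set (EuclideanSpace ℝ (Fin n)),
      MeasurableSet A → MeasurableSet Z → MeasurableSet S → A ⊆ ball 0 1 → Z ⊆ ball 0 1 →
      (∀ᵐ x ∂volume.restrict A, 1 / 2 ≤ u x) → (∀ᵐ x ∂volume.restrict Z, u x ≤ 0) →
      (∀ᵐ x ∂volume.restrict (ball 0 1), 0 < u x → u x < 1 / 2 → x ∈ S) →
        volume A * volume Z ≤ ENNReal.ofReal C * volume Z ^ (1 / (n : ℝ)) *
          (volume S ^ (1 / 2 : ℝ) * eLpNorm G 2 (volume.restrict (ball 0 1))) := by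
  obtain ⟨C, hC, H⟩ := exists_mul_measure_le_lintegral hn
  obtain ⟨η, hη, hη0, hη1, M, hM, hηM⟩ := exists_contDiff_cutoff (b := 1 / 2) (by norm_num)
  refine ⟨C * M, by positivity, fun u G h hu hG A Z S hA hZ hS hAB hZB hAu hZu hSu => ?_⟩
  set B := ball (0 : EuclideanSpace ℝ (Fin n)) 1 with hB
  have : IsFiniteMeasure (volume.restrict B) := ⟨by simpa using measure_ball_lt_top⟩
  have hGi : Integrable (B.indicator G) :=
    (integrable_indicator_iff measurableSet_ball).2 (hG.integrable (by norm_num))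
  have hηM' : ∀ t, ‖deriv η t‖ ≤ M := fun t => (hηM t).trans (indicator_le_self' (fun _ _ => hM.le) t)
  have hcs : ∫⁻ x in B, ‖deriv η (u x)‖ₑ * ‖G x‖ₑ ≤
      ENNReal.ofReal M * (volume S ^ (1 / 2 : ℝ) * eLpNorm G 2 (volume.restrict B)) := by
    calc ∫⁻ x in B, ‖deriv η (u x)‖ₑ * ‖G x‖ₑ
        ≤ ∫⁻ x in B, ENNReal.ofReal M * (S.indicator 1 x * ‖G x‖ₑ) := by
          refine lintegral_mono_ae ?_
          filter_upwards [hSu] with x hx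
          rw [← mul_assoc]
          gcongr
          by_cases hux : u x ∈ Ioo 0 (1 / 2 : ℝ)
          · rw [indicator_of_mem (hx hux.1 hux.2), Pi.one_apply, mul_one, ← ofReal_norm]
            exact ENNReal.ofReal_le_ofReal (hηM' _)
          · have := hηM (u x)
            rw [indicator_of_notMem hux, norm_le_zero_iff] at this
            simp [this]
      _ = ENNReal.ofReal M * ∫⁻ x in B, S.indicator 1 x * ‖G x‖ₑ :=
          lintegral_const_mul' _ _ ofReal_ne_top
      _ ≤ _ := by
          gcongr
          -- Cauchy–Schwarz against the indicator of `S`, which is its own square; this produces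
          -- `|S|^(1/2)`.
          have hh := ENNReal.lintegral_mul_le_Lp_mul_Lq (volume.restrict B)
            (p := 2) (q := 2) (f := S.indicator 1) (g := fun x => ‖G x‖ₑ)
            Real.HolderConjugate.two_two ((measurable_one.indicator hS).aemeasurable)
            hG.aestronglyMeasurable.enorm
          refine hh.trans ?_
          gcongr
          · have e : ∀ x, (S.indicator 1 x : ℝ≥0∞) ^ (2 : ℝ) = S.indicator 1 x := fun x => by
              by_cases hx : x ∈ S <;> simp [hx]
            simp_rw [e]
            rw [lintegral_indicator_one hS]
            exact Measure.restrict_apply_le _ _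
          · rw [eLpNorm_eq_lintegral_rpow_enorm_toReal (by norm_num) (by norm_num)]
            simp
  refine measure_mul_measure_le_of_forall_ball hAB hZB fun r hr => ?_
  have hmain := H u G h hu hGi r hr (A ∩ ball 0 r) (Z ∩ ball 0 r) (hA.inter measurableSet_ball)
    (hZ.inter measurableSet_ball) inter_subset_right inter_subset_right η M hη hηM'
  -- Almost everywhere `η ∘ u` is `1` on `A` and `0` on `Z`, so the integrand is `1`.
  have hL : ∫⁻ y in Z ∩ ball 0 r, ∫⁻ x in A ∩ ball 0 r, ‖η (u x) - η (u y)‖ₑ =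
      volume (A ∩ ball 0 r) * volume (Z ∩ ball 0 r) := by
    have h1 : ∀ᵐ y ∂volume.restrict (Z ∩ ball 0 r),
        ∫⁻ x in A ∩ ball 0 r, ‖η (u x) - η (u y)‖ₑ = volume (A ∩ ball 0 r) := by
      filter_upwards [ae_restrict_of_ae_restrict_of_subset inter_subset_left hZu] with y hy
      rw [← setLIntegral_one]
      refine lintegral_congr_ae ?_
      filter_upwards [ae_restrict_of_ae_restrict_of_subset inter_subset_left hAu] with x hx
      rw [hη0 _ hy, hη1 _ hx]; simp
    rw [lintegral_congr_ae h1, setLIntegral_const]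
  rw [hL] at hmain
  calc _ ≤ _ := hmain
    _ ≤ ENNReal.ofReal C * volume Z ^ (1 / (n : ℝ)) * (ENNReal.ofReal M *
          (volume S ^ (1 / 2 : ℝ) * eLpNorm G 2 (volume.restrict B))) := by
        gcongr
        exact inter_subset_left
    _ = _ := by rw [ENNReal.ofReal_mul hC.le]; ring

theorem le_of_mul_le_mul_rpow_mul_sqrt {n : ℕ} {K a z s D : ℝ} (hK : 0 < K)
    (ha : 0 ≤ a) (hz : 0 < z) (hs : 0 ≤ s) (hD : 0 < D)
    (h : a * z ≤ K * z ^ (1 / (n : ℝ)) * (s ^ (1 / 2 : ℝ) * D)) :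
    1 / K ^ 2 / D ^ 2 * a ^ 2 * z ^ (2 - 2 / (n : ℝ)) ≤ s := by
  have hp : 0 < z ^ (1 / (n : ℝ)) := Real.rpow_pos_of_pos hz _
  have h1 : a * z ^ (1 - 1 / (n : ℝ)) ≤ K * (s ^ (1 / 2 : ℝ) * D) := by
    rw [Real.rpow_sub hz, Real.rpow_one, ← mul_div_assoc, div_le_iff₀ hp]
    linarith
  have h2 : z ^ (2 - 2 / (n : ℝ)) = (z ^ (1 - 1 / (n : ℝ))) ^ 2 := by
    rw [← Real.rpow_mul_natCast hz.le]
    congr 1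
    push_cast
    ring
  have h3 : (s ^ (1 / 2 : ℝ)) ^ 2 = s := by
    rw [← Real.sqrt_eq_rpow, Real.sq_sqrt hs]
  have h4 := pow_le_pow_left₀ (by positivity) h1 2
  rw [mul_pow, mul_pow, mul_pow, h3, ← h2] at h4
  rw [div_div, div_mul_eq_mul_div, div_mul_eq_mul_div, one_mul, div_le_iff₀ (by positivity)]
  linarith

end Main

theorem lemma2p9 (n : ℕ) (hn : 1 ≤ n) :
    ∃ C : ℝ, 0 < C ∧
      ∀ g : EuclideanSpace ℝ (Fin n) → ℝ,
        AEMeasurable g (volume.restrict (ball 0 1)) →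
        MemH1 (ball 0 1) (fun x => max (g x) 0) →
        ∀ G : EuclideanSpace ℝ (Fin n) → EuclideanSpace ℝ (Fin n),
          HasWeakGradientOn (ball 0 1) (fun x => max (g x) 0) G →
          l2NormOn (ball 0 1) G ≠ 0 →
          (n = 1 → volume.real (ball 0 1 ∩ {x | g x ≤ 0}) ≠ 0) →
          volume.real (ball 0 1 ∩ {x | 0 < g x ∧ g x < 1 / 2}) ≥
            C / l2NormOn (ball 0 1) G ^ 2 *
              volume.real (ball 0 1 ∩ {x | g x ≥ 1 / 2}) ^ 2 *
              volume.real (ball 0 1 ∩ {x | g x ≤ 0}) ^ (2 - 2 / (n : ℝ)) := by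
  obtain ⟨K, hK, H⟩ := exists_mul_measure_le_mul_eLpNorm hn
  refine ⟨1 / K ^ 2, by positivity, fun g hg hH1 G hG hG0 hn1 => ?_⟩
  set B := ball (0 : EuclideanSpace ℝ (Fin n)) 1 with hB
  have hBm : MeasurableSet B := measurableSet_ball
  have hfin : IsFiniteMeasure (volume.restrict B) := ⟨by simpa using measure_ball_lt_top⟩
  set D := l2NormOn B G with hD
  have hD0 : 0 < D := lt_of_le_of_ne ENNReal.toReal_nonneg hG0.symm
  -- `G` is an arbitrary weak gradient, not the one supplied by `MemH1`. Its norm is finite because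
  -- `toReal` would send `⊤` to `0`, contrary to `hG0`.
  have hDt : eLpNorm G 2 (volume.restrict B) ≠ ⊤ := by
    intro h
    exact hG0 (by rw [hD, l2NormOn, h, ENNReal.toReal_top])
  have hG2 : MemLp G 2 (volume.restrict B) :=
    ⟨hG.locallyIntegrableOn_grad.aestronglyMeasurable, hDt.lt_top⟩
  have hu : Integrable (B.indicator fun x => max (g x) 0) :=
    (integrable_indicator_iff hBm).2 (hH1.1.integrable (by norm_num))
  have hgg : g =ᵐ[volume.restrict B] hg.mk g := hg.ae_eq_mk
  have hgm : Measurable (hg.mk g) := hg.measurable_mk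
  have hvol : ∀ T : Set ℝ, volume.real (B ∩ g ⁻¹' T) = volume.real (B ∩ hg.mk g ⁻¹' T) := by
    intro T
    refine measureReal_congr ?_
    have h1 := (ae_restrict_iff' hBm).1 hgg
    filter_upwards [h1] with x hx
    refine propext (and_congr_right fun hxB => ?_)
    change g x ∈ T ↔ hg.mk g x ∈ T
    rw [hx hxB]
  have eZ : volume.real (B ∩ {x | g x ≤ 0}) = volume.real (B ∩ hg.mk g ⁻¹' Set.Iic 0) :=
    hvol (Set.Iic 0)
  have eA : volume.real (B ∩ {x | g x ≥ 1 / 2}) =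
      volume.real (B ∩ hg.mk g ⁻¹' Set.Ici (1 / 2)) := hvol (Set.Ici (1 / 2))
  have eS : volume.real (B ∩ {x | 0 < g x ∧ g x < 1 / 2}) =
      volume.real (B ∩ hg.mk g ⁻¹' Set.Ioo 0 (1 / 2)) := hvol (Set.Ioo 0 (1 / 2))
  rw [eZ] at hn1 ⊢
  rw [eA, eS]
  set Z := B ∩ hg.mk g ⁻¹' Set.Iic 0 with hZ
  set A := B ∩ hg.mk g ⁻¹' Set.Ici (1 / 2) with hA
  set S := B ∩ hg.mk g ⁻¹' Set.Ioo 0 (1 / 2) with hS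
  have hZm : MeasurableSet Z := hBm.inter (hgm measurableSet_Iic)
  have hAm : MeasurableSet A := hBm.inter (hgm measurableSet_Ici)
  have hSm : MeasurableSet S := hBm.inter (hgm measurableSet_Ioo)
  have hmain := H _ G hG hu hG2 A Z S hAm hZm hSm Set.inter_subset_left Set.inter_subset_left
    (by
      filter_upwards [ae_restrict_of_ae_restrict_of_subset Set.inter_subset_left hgg,
        ae_restrict_mem hAm] with x h1 h2
      rw [h1]
      exact le_max_of_le_left h2.2)
    (by
      filter_upwards [ae_restrict_of_ae_restrict_of_subset Set.inter_subset_left hgg,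
        ae_restrict_mem hZm] with x h1 h2
      rw [h1]
      exact max_le h2.2 le_rfl)
    (by
      filter_upwards [hgg, ae_restrict_mem hBm] with x h1 h2 h3 h4
      rw [h1] at h3 h4
      rcases lt_max_iff.1 h3 with h5 | h5
      · exact ⟨h2, h5, (le_max_left _ _).trans_lt h4⟩
      · exact absurd h5 (lt_irrefl _))
  have hmt : ∀ T : Set ℝ, volume (B ∩ hg.mk g ⁻¹' T) ≠ ⊤ := fun T =>
    ((measure_mono Set.inter_subset_left).trans_lt measure_ball_lt_top).ne
  -- If `|Z| = 0`, division by `|Z|^(1/n)` is impossible. For `n ≥ 2` the exponent `2 - 2/n` is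
  -- nonzero and the right side vanishes; for `n = 1` it would be `0 ^ 0 = 1`, the case that `hn1`
  -- excludes.
  rcases eq_or_ne (volume.real Z) 0 with hz | hz
  · have hn' : n ≠ 1 := fun h => hn1 h hz
    have hn2 : (2 : ℝ) ≤ n := by exact_mod_cast (by omega : 2 ≤ n)
    have hexp : 2 - 2 / (n : ℝ) ≠ 0 := by
      have : 2 / (n : ℝ) ≤ 1 := by rw [div_le_one (by linarith)]; exact hn2
      linarith
    rw [hz, Real.zero_rpow hexp, mul_zero]
    exact measureReal_nonneg
  · refine le_of_mul_le_mul_rpow_mul_sqrt hK measureReal_nonneg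
      (lt_of_le_of_ne measureReal_nonneg hz.symm) measureReal_nonneg hD0 ?_
    have h1 := ENNReal.toReal_mono (ENNReal.mul_ne_top (ENNReal.mul_ne_top ENNReal.ofReal_ne_top
      (ENNReal.rpow_ne_top_of_nonneg (by positivity) (hmt _)))
      (ENNReal.mul_ne_top (ENNReal.rpow_ne_top_of_nonneg (by positivity) (hmt _)) hDt)) hmain
    simp only [ENNReal.toReal_mul, ← ENNReal.toReal_rpow, ENNReal.toReal_ofReal hK.le] at h1
    exact h1
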